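/- All spaces are Tychonoff. For a space $X$, a network of $X$ is a family $\mathcal N$ of subsets of $X$ such that every open set of $X$ is the union of a subfamily of $\mathcal N$; a base is a network consisting of open sets. Let $w(X)$ and $nw(X)$ denote the weight and the network weight of $X$, i.e. $w(X)=\min\{|\mathcal B| : \mathcal B \text{ is a base of } X\}+\omega$ and $nw(X)=\min\{|\mathcal N| : \mathcal N \text{ is a network of } X\}+\omega$. A Lindelöf $p$-space is a space that admits a perfect map (continuous, closed, with compact fibres) onto a space with a countable base, and a Lindelöf $\Sigma$-space is a continuous image of a Lindelöf $p$-space. Let $K$ be a compact convex subset of a Hausdorff locally convex real topological vector space, and let $B\subseteq K$ be a boundary of $K$, i.e. for every continuous affine function $f:K\to\mathbb R$ there is $b\in B$ with $f(b)=\max_{x\in K} f(x)$. If $B$, with the subspace topology, is a Lindelöf $\Sigma$-space, then $w(K)\le nw(B)$, and hence $w(K)=nw(B)$. -/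

import Mathlib

open Set Topology Cardinal

universe u v

/-- A family `N` of subsets of `X` is a network of `X` if every open set is the union of a
subfamily of `N`. -/
def IsNetwork {X : Type u} [TopologicalSpace X] (N : Set (Set X)) : Prop :=
  ∀ U : Set X, IsOpen U → ∃ M : Set (Set X), M ⊆ N ∧ U = ⋃₀ M

/-- The weight `w(X)`: the least cardinality of a base of `X`, plus `ω`. -/
noncomputable def topWeight (X : Type u) [TopologicalSpace X] : Cardinal.{u} :=
  sInf {c : Cardinal.{u} | ∃ B : Set (Set X), TopologicalSpace.IsTopologicalBasis B ∧ #B = c} + ℵ₀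

/-- The network weight `nw(X)`: the least cardinality of a network of `X`, plus `ω`. -/
noncomputable def netWeight (X : Type u) [TopologicalSpace X] : Cardinal.{u} :=
  sInf {c : Cardinal.{u} | ∃ N : Set (Set X), IsNetwork N ∧ #N = c} + ℵ₀

/-- A perfect map: continuous, closed, with compact fibres. -/
def IsPerfectMap {Y Z : Type*} [TopologicalSpace Y] [TopologicalSpace Z] (p : Y → Z) : Prop :=
  Continuous p ∧ IsClosedMap p ∧ ∀ z : Z, IsCompact (p ⁻¹' {z})

/-- A Lindelöf p-space: a Tychonoff space admitting a perfect map onto a Tychonoff space with a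
countable base. (The image of a surjection from `Y : Type v` can always be taken in `Type v`.) -/
def IsLindelofPSpace (Y : Type v) [TopologicalSpace Y] : Prop :=
  T35Space Y ∧ ∃ (Z : Type v) (_ : TopologicalSpace Z) (p : Y → Z),
    T35Space Z ∧ SecondCountableTopology Z ∧ IsPerfectMap p ∧ Function.Surjective p

/-- A Lindelöf Σ-space: a continuous image of a Lindelöf p-space. The Lindelöf p-space may live in
any universe `v`. -/
def IsLindelofSigmaSpace (X : Type u) [TopologicalSpace X] : Prop :=
  ∃ (Y : Type v) (_ : TopologicalSpace Y) (f : Y → X),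
    IsLindelofPSpace Y ∧ Continuous f ∧ Function.Surjective f

/-- `f` restricts to a continuous affine function on the convex set `K`. -/
def IsContAffineOn {E : Type*} [AddCommGroup E] [Module ℝ E] [TopologicalSpace E]
    (K : Set E) (f : E → ℝ) : Prop :=
  ContinuousOn f K ∧ ∀ x ∈ K, ∀ y ∈ K, ∀ a b : ℝ, 0 ≤ a → 0 ≤ b → a + b = 1 →
    f (a • x + b • y) = a * f x + b * f y

/-- `B` is a boundary of the convex compact set `K`: `B ⊆ K` and every continuous affine function
on `K` attains its maximum over `K` at a point of `B`. -/
def IsBoundaryOf {E : Type*} [AddCommGroup E] [Module ℝ E] [TopologicalSpace E]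
    (B K : Set E) : Prop :=
  B ⊆ K ∧ ∀ f : E → ℝ, IsContAffineOn K f → ∃ b ∈ B, ∀ x ∈ K, f x ≤ f b

/-! A compact space has weight at most the size of any point-separating family of continuous
functions, so it suffices to find `netWeight B` many continuous affine functions that separate the
points of `K`. The bounded continuous affine functions separate points by Hahn–Banach, but there may
be too many of them.

The Σ-structure of `B` thins them out: `IsLindelofSigmaSpace.exists_sequentially_dense` gives a
small subfamily `D` from which each function is a pointwise limit on `B` of a sequence. The limit
must be sequential, because Simons' argument (`IsBoundaryOf.false_of_tendsto_zero`) carries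
convergence of bounded sequences, not nets, from a boundary to all of `K`. Hence two points of `K`
not separated by `D` are separated by no function at all.

The reverse inequality holds because the traces on `B` of a base of `K` form a network. -/

open Filter

/-! ### Affine functions and Simons' lemma -/

section Affine

variable {E : Type*} [AddCommGroup E] [Module ℝ E] [TopologicalSpace E] {K B : Set E}

theorem IsContAffineOn.add {f g : E → ℝ} (hf : IsContAffineOn K f) (hg : IsContAffineOn K g) :
    IsContAffineOn K (fun y => f y + g y) := by
  refine ⟨hf.1.add hg.1, fun x hx y hy a b ha hb hab => ?_⟩
  simp only [hf.2 x hx y hy a b ha hb hab, hg.2 x hx y hy a b ha hb hab]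
  ring

theorem IsContAffineOn.const_mul {f : E → ℝ} (hf : IsContAffineOn K f) (c : ℝ) :
    IsContAffineOn K (fun y => c * f y) := by
  refine ⟨continuousOn_const.mul hf.1, fun x hx y hy a b ha hb hab => ?_⟩
  simp only [hf.2 x hx y hy a b ha hb hab]
  ring

theorem IsContAffineOn.sub {f g : E → ℝ} (hf : IsContAffineOn K f) (hg : IsContAffineOn K g) :
    IsContAffineOn K (fun y => f y - g y) := by
  simpa [sub_eq_add_neg] using hf.add (hg.const_mul (-1))

theorem IsContAffineOn.of_strongDual (f : StrongDual ℝ E) : IsContAffineOn K f :=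
  ⟨f.continuous.continuousOn, fun x _ y _ a b _ _ _ => by simp⟩

theorem summable_half_pow_mul {u : ℕ → ℝ} {M : ℝ} (hu : ∀ n, |u n| ≤ M) :
    Summable fun n => (1 / 2 : ℝ) ^ (n + 1) * u n := by
  have h : Summable fun n : ℕ => (1 / 2 : ℝ) ^ (n + 1) * M :=
    ((summable_nat_add_iff 1).2 summable_geometric_two).mul_right M
  refine Summable.of_norm_bounded h fun n => ?_
  rw [Real.norm_eq_abs, abs_mul, abs_of_nonneg (by positivity : (0 : ℝ) ≤ (1 / 2) ^ (n + 1))]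
  gcongr
  exact hu n

theorem hasSum_half_pow_mul_const (c : ℝ) : HasSum (fun n : ℕ => (1 / 2 : ℝ) ^ (n + 1) * c) c := by
  have h := (hasSum_geometric_two.mul_left (1 / 2 : ℝ)).mul_right c
  simpa [pow_succ'] using h

theorem tsum_half_pow_mul_le {u : ℕ → ℝ} {M c : ℝ} (hu : ∀ n, |u n| ≤ M) (hc : ∀ n, u n ≤ c) :
    ∑' n, (1 / 2 : ℝ) ^ (n + 1) * u n ≤ c :=
  (hasSum_le (fun n => mul_le_mul_of_nonneg_left (hc n) (by positivity))
    (summable_half_pow_mul hu).hasSum (hasSum_half_pow_mul_const c))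

theorem le_tsum_half_pow_mul {u : ℕ → ℝ} {M c : ℝ} (hu : ∀ n, |u n| ≤ M) (hc : ∀ n, c ≤ u n) :
    c ≤ ∑' n, (1 / 2 : ℝ) ^ (n + 1) * u n :=
  (hasSum_le (fun n => mul_le_mul_of_nonneg_left (hc n) (by positivity))
    (hasSum_half_pow_mul_const c) (summable_half_pow_mul hu).hasSum)

/-- Uniform convergence (the Weierstrass test) preserves continuity. The weights sum to 1, so these
series are infinite convex combinations. -/
theorem IsContAffineOn.tsum_half_pow_mul {g : ℕ → E → ℝ} {M : ℝ}
    (hg : ∀ n, IsContAffineOn K (g n)) (hM : ∀ n, ∀ y ∈ K, |g n y| ≤ M) :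
    IsContAffineOn K (fun y => ∑' n, (1 / 2 : ℝ) ^ (n + 1) * g n y) := by
  constructor
  · have h : Summable fun n : ℕ => (1 / 2 : ℝ) ^ (n + 1) * M :=
      ((summable_nat_add_iff 1).2 summable_geometric_two).mul_right M
    refine continuousOn_tsum (fun n => ((hg n).const_mul _).1) h fun n y hy => ?_
    rw [Real.norm_eq_abs, abs_mul, abs_of_nonneg (by positivity : (0 : ℝ) ≤ (1 / 2) ^ (n + 1))]
    gcongr
    exact hM n y hy
  · intro x hx y hy a b ha hb hab
    have sx := summable_half_pow_mul (fun n => hM n x hx)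
    have sy := summable_half_pow_mul (fun n => hM n y hy)
    rw [← tsum_mul_left, ← tsum_mul_left, ← (sx.mul_left a).tsum_add (sy.mul_left b)]
    refine tsum_congr fun n => ?_
    rw [(hg n).2 x hx y hy a b ha hb hab]
    ring

/-- Approximate minimization of the least upper bound of `v + t g` over `g ∈ C`. -/
theorem exists_approx_minimizer {α : Type*} {K : Set α} {C : Set (α → ℝ)} (hC : C.Nonempty)
    {x : α} (hx : x ∈ K) {δ : ℝ} (hδ : ∀ g ∈ C, δ ≤ g x) (v : α → ℝ) {t ε : ℝ} (ht : 0 ≤ t)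
    (hε : 0 < ε) :
    ∃ g ∈ C, ∀ g' ∈ C, ∀ m, (∀ y ∈ K, v y + t * g' y ≤ m) → ∀ y ∈ K, v y + t * g y ≤ m + ε := by
  set R : Set ℝ := {m | ∃ g' ∈ C, ∀ y ∈ K, v y + t * g' y ≤ m} with hR
  by_cases hne : R.Nonempty
  · obtain ⟨m₀, ⟨g, hgC, hg⟩, hm₀⟩ := Real.lt_sInf_add_pos hne hε
    refine ⟨g, hgC, fun g' hg' m hm y hy => (hg y hy).trans (hm₀.le.trans ?_)⟩
    have hbdd : BddBelow R := by
      refine ⟨v x + t * δ, ?_⟩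
      rintro m ⟨g, hgC, hg⟩
      exact le_trans (by gcongr; exact hδ g hgC) (hg x hx)
    linarith [csInf_le hbdd (show m ∈ R from ⟨g', hg', hm⟩)]
  · obtain ⟨g, hg⟩ := hC
    exact ⟨g, hg, fun g' hg' m hm => (hne ⟨m, g', hg', hm⟩).elim⟩

/-- Simons' lemma: a uniformly bounded sequence of continuous affine functions that tends to `0`
on a boundary cannot stay above a positive constant at a point. -/
theorem IsBoundaryOf.false_of_tendsto_zero (hB : IsBoundaryOf B K)
    {h : ℕ → E → ℝ} {M : ℝ} (hh : ∀ n, IsContAffineOn K (h n)) (hM : ∀ n, ∀ y ∈ K, |h n y| ≤ M)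
    (hlim : ∀ b ∈ B, Tendsto (fun n => h n b) atTop (𝓝 0)) {x : E} (hx : x ∈ K) {δ : ℝ}
    (hδ : 0 < δ) (hhx : ∀ n, δ ≤ h n x) : False := by
  -- `C n` plays the role of the closed convex hull of the tail `h k`, `k ≥ n`; the last clause,
  -- domination by the supremum of the tail, is all that is needed and passes to infinite convex
  -- combinations.
  set C : ℕ → Set (E → ℝ) := fun n => {g | IsContAffineOn K g ∧ (∀ y ∈ K, |g y| ≤ M) ∧ δ ≤ g x ∧
    ∀ y ∈ K, ∀ c, (∀ k, n ≤ k → h k y ≤ c) → g y ≤ c} with hC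
  have hCne : ∀ n, (C n).Nonempty := fun n =>
    ⟨h n, hh n, hM n, hhx n, fun y _ c hc => hc n le_rfl⟩
  have hstep : ∀ (n : ℕ) (v : E → ℝ), ∃ g ∈ C n, ∀ g' ∈ C n, ∀ m,
      (∀ y ∈ K, v y + (1 / 2 : ℝ) ^ n * g' y ≤ m) →
      ∀ y ∈ K, v y + (1 / 2 : ℝ) ^ n * g y ≤ m + (1 / 2 : ℝ) ^ n * (δ / 4 * (1 / 2) ^ n) :=
    fun n v => exists_approx_minimizer (hCne n) hx (fun g hg => hg.2.2.1) v (by positivity)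
      (by positivity)
  choose G hGC hG using hstep
  -- `v n` is the sum of the first `n` terms of `T 0`. Each `g n` is chosen greedily, as if it were
  -- to carry the whole remaining weight `(1/2)^n`.
  let v : ℕ → E → ℝ := fun n =>
    Nat.rec (fun _ => 0) (fun k w y => w y + (1 / 2 : ℝ) ^ (k + 1) * G k w y) n
  let g : ℕ → E → ℝ := fun n => G n (v n)
  have hg : ∀ n, g n ∈ C n := fun n => hGC n (v n)
  have hgM : ∀ n, ∀ y ∈ K, |g n y| ≤ M := fun n => (hg n).2.1
  let T : ℕ → E → ℝ := fun n y => ∑' p, (1 / 2 : ℝ) ^ (p + 1) * g (n + p) y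
  have hTC : ∀ n, T n ∈ C n := by
    intro n
    refine ⟨IsContAffineOn.tsum_half_pow_mul (fun p => (hg _).1) (fun p => hgM _), ?_, ?_, ?_⟩
    · intro y hy
      exact abs_le.2 ⟨le_tsum_half_pow_mul (fun p => hgM _ y hy) fun p => (abs_le.1 (hgM _ y hy)).1,
        tsum_half_pow_mul_le (fun p => hgM _ y hy) fun p => (abs_le.1 (hgM _ y hy)).2⟩
    · exact le_tsum_half_pow_mul (fun p => hgM _ x hx) fun p => (hg _).2.2.1
    · intro y hy c hc
      exact tsum_half_pow_mul_le (fun p => hgM _ y hy) fun p =>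
        (hg _).2.2.2 y hy c fun k hk => hc k (by omega)
  have hTsucc : ∀ n, ∀ y ∈ K, T n y = (1 / 2) * g n y + (1 / 2) * T (n + 1) y := by
    intro n y hy
    have s := summable_half_pow_mul (fun p => hgM (n + p) y hy)
    simp only [T]
    rw [s.tsum_eq_zero_add, ← tsum_mul_left]
    congr 1
    · simp
    · refine tsum_congr fun p => ?_
      rw [show n + (p + 1) = n + 1 + p by ring]
      ring
  have hV : ∀ n, ∀ y ∈ K, v n y + (1 / 2) ^ n * T n y = T 0 y := by
    intro n y hy
    induction n with
    | zero => simp [v]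
    | succ n ih =>
      rw [← ih, hTsucc n y hy]
      change v n y + (1 / 2 : ℝ) ^ (n + 1) * g n y + _ = _
      ring
  obtain ⟨b, hbB, hb⟩ := hB.2 (T 0) (hTC 0).1
  have hbK := hB.1 hbB
  have hgT : ∀ n, g n b ≤ T n b + δ / 4 * (1 / 2) ^ n := by
    intro n
    -- The normalized tail `T n` competes with `g n` in `C n`, and with it the total is `T 0`, whose
    -- maximum is at `b`.
    have h1 := hG n (v n) (T n) (hTC n) (T 0 b) (fun y hy => (hV n y hy).trans_le (hb y hy)) b hbK
    rw [← hV n b hbK, add_assoc, ← mul_add] at h1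
    exact le_of_mul_le_mul_left (le_of_add_le_add_left h1) (by positivity)
  -- Each step loses at most `δ/4 * (1/2)^n`, hence less than `δ/2` in total; so `T n b` stays above
  -- `δ/2`, while domination by the tail of `h` at `b` forces it below `δ/4`.
  have hdec : ∀ n, T 0 b ≤ T n b + δ / 2 * (1 - (1 / 2) ^ n) := by
    intro n
    induction n with
    | zero => simp
    | succ n ih =>
      have h1 := hgT n
      have h2 := hTsucc n b hbK
      rw [pow_succ]
      linarith
  have h0 : δ ≤ T 0 b := (hTC 0).2.2.1.trans (hb x hx)
  obtain ⟨n, hn⟩ := eventually_atTop.1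
    ((hlim b hbB).eventually_le_const (show 0 < δ / 4 by positivity))
  have h1 := (hTC n).2.2.2 b hbK (δ / 4) hn
  have h2 := hdec n
  have h3 : 0 ≤ δ / 2 * (1 / 2 : ℝ) ^ n := by positivity
  linarith

/-- Bounded sequences of continuous affine functions converging on a boundary converge
everywhere. -/
theorem IsBoundaryOf.tendsto_of_tendsto (hB : IsBoundaryOf B K)
    {F : ℕ → E → ℝ} {f : E → ℝ} (hF : ∀ n, IsContAffineOn K (F n)) (hf : IsContAffineOn K f)
    {M : ℝ} (hFM : ∀ n, ∀ y ∈ K, |F n y| ≤ M) (hfM : ∀ y ∈ K, |f y| ≤ M)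
    (hlim : ∀ b ∈ B, Tendsto (fun n => F n b) atTop (𝓝 (f b))) {x : E} (hx : x ∈ K) :
    Tendsto (fun n => F n x) atTop (𝓝 (f x)) := by
  -- The signs `s = 1` and `s = -1` give the two one-sided estimates; a failure yields a subsequence
  -- contradicting Simons' lemma.
  have key : ∀ s : ℝ, |s| = 1 → ∀ ε > 0, ∀ᶠ n in atTop, s * (F n x - f x) < ε := by
    intro s hs ε hε
    by_contra hcon
    have hcon' : ∃ᶠ n in atTop, ε ≤ s * (F n x - f x) := by
      simpa only [not_eventually, not_lt] using hcon
    obtain ⟨φ, hφ, hφx⟩ := extraction_of_frequently_atTop hcon'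
    refine hB.false_of_tendsto_zero (h := fun n y => s * (F (φ n) y - f y)) (M := M + M)
      (fun n => ((hF _).sub hf).const_mul s) (fun n y hy => ?_) (fun b hb => ?_) hx hε hφx
    · rw [abs_mul, hs, one_mul]
      exact (abs_sub _ _).trans (add_le_add (hFM _ y hy) (hfM y hy))
    · simpa using (((hlim b hb).comp hφ.tendsto_atTop).sub_const (f b)).const_mul s
  rw [Metric.tendsto_atTop']
  intro ε hε
  obtain ⟨N, hN⟩ := eventually_atTop.1
    ((key 1 (by simp) ε hε).and (key (-1) (by simp) ε hε))
  refine ⟨N, fun n hn => ?_⟩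
  rw [Real.dist_eq, abs_lt]
  constructor <;> linarith [(hN n hn.le).1, (hN n hn.le).2]

end Affine

/-! ### Weight, network weight and separating families -/

section Weight

theorem exists_isNetwork_mk_le (X : Type u) [TopologicalSpace X] :
    ∃ N : Set (Set X), IsNetwork N ∧ #N ≤ netWeight X := by
  have hne : {c : Cardinal.{u} | ∃ N : Set (Set X), IsNetwork N ∧ #N = c}.Nonempty :=
    ⟨_, Set.univ, fun U _ => ⟨{U}, subset_univ _, by simp⟩, rfl⟩
  obtain ⟨N, hN, hc⟩ := csInf_mem hne
  exact ⟨N, hN, hc.trans_le (self_le_add_right _ _)⟩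

theorem exists_isTopologicalBasis_mk_le (X : Type u) [TopologicalSpace X] :
    ∃ B : Set (Set X), TopologicalSpace.IsTopologicalBasis B ∧ #B ≤ topWeight X := by
  have hne : {c : Cardinal.{u} | ∃ B : Set (Set X),
      TopologicalSpace.IsTopologicalBasis B ∧ #B = c}.Nonempty :=
    ⟨_, _, TopologicalSpace.isTopologicalBasis_opens, rfl⟩
  obtain ⟨B, hB, hc⟩ := csInf_mem hne
  exact ⟨B, hB, hc.trans_le (self_le_add_right _ _)⟩

theorem aleph0_le_netWeight (X : Type u) [TopologicalSpace X] : ℵ₀ ≤ netWeight X :=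
  self_le_add_left _ _

theorem aleph0_le_topWeight (X : Type u) [TopologicalSpace X] : ℵ₀ ≤ topWeight X :=
  self_le_add_left _ _

theorem netWeight_le {X : Type u} [TopologicalSpace X] {N : Set (Set X)} (hN : IsNetwork N)
    {κ : Cardinal.{u}} (hκ : ℵ₀ ≤ κ) (h : #N ≤ κ) : netWeight X ≤ κ := by
  refine add_le_of_le hκ (le_trans (csInf_le' ?_) h) hκ
  exact ⟨N, hN, rfl⟩

theorem topWeight_le {X : Type u} [TopologicalSpace X] {B : Set (Set X)}
    (hB : TopologicalSpace.IsTopologicalBasis B) {κ : Cardinal.{u}} (hκ : ℵ₀ ≤ κ) (h : #B ≤ κ) :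
    topWeight X ≤ κ := by
  refine add_le_of_le hκ (le_trans (csInf_le' ?_) h) hκ
  exact ⟨B, hB, rfl⟩

theorem mk_finset_le {α : Type u} {κ : Cardinal.{u}} (hκ : ℵ₀ ≤ κ) (h : #α ≤ κ) :
    #(Finset α) ≤ κ := by
  cases finite_or_infinite α
  · exact (lt_aleph0_of_finite _).le.trans hκ
  · rwa [mk_finset_of_infinite]

/-- The network weight of a subspace is at most the weight of the whole space. -/
theorem netWeight_le_topWeight_of_isInducing {X Y : Type u} [TopologicalSpace X]
    [TopologicalSpace Y] {f : X → Y} (hf : IsInducing f) : netWeight X ≤ topWeight Y := by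
  obtain ⟨B, hB, hBc⟩ := exists_isTopologicalBasis_mk_le Y
  refine netWeight_le (N := preimage f '' B) ?_ (aleph0_le_topWeight Y) (mk_image_le.trans hBc)
  intro U hU
  obtain ⟨M, hM, rfl⟩ := (hB.isInducing hf).open_eq_sUnion hU
  exact ⟨M, hM, rfl⟩

theorem Continuous.eq_induced_of_injective {X Y : Type*} [tX : TopologicalSpace X]
    [tY : TopologicalSpace Y] [CompactSpace X] [T2Space Y] {f : X → Y} (hf : Continuous f)
    (hinj : Function.Injective f) : tX = tY.induced f :=
  (hf.isClosedEmbedding hinj).isInducing.eq_induced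

/-- A compact space has weight at most the cardinality of any family of continuous functions
separating its points. -/
theorem topWeight_le_of_separates {X : Type u} [tX : TopologicalSpace X] [CompactSpace X]
    {D : Set (X → ℝ)} (hcont : ∀ d ∈ D, Continuous d)
    (hsep : ∀ x y : X, x ≠ y → ∃ d ∈ D, d x ≠ d y) {κ : Cardinal.{u}} (hκ : ℵ₀ ≤ κ)
    (hD : #D ≤ κ) : topWeight X ≤ κ := by
  let I : Set (Set X) := range fun p : D × ℚ × ℚ => p.1.1 ⁻¹' Ioo (p.2.1 : ℝ) p.2.2
  have hIc : #I ≤ κ := by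
    refine mk_range_le.trans ?_
    rw [mk_prod]
    simp only [lift_uzero]
    exact mul_le_of_le hκ hD (by simpa using hκ)
  -- A Hausdorff topology coarser than a compact one coincides with it.
  have hgen : tX = TopologicalSpace.generateFrom I := by
    have hle : tX ≤ TopologicalSpace.generateFrom I := by
      refine le_generateFrom ?_
      rintro _ ⟨⟨d, q, r⟩, rfl⟩
      exact isOpen_Ioo.preimage (hcont d d.2)
    have hT2 : @T2Space X (TopologicalSpace.generateFrom I) := by
      refine @T2Space.mk X (TopologicalSpace.generateFrom I) ?_
      intro x y hxy
      have aux : ∀ x y : X, (∃ d ∈ D, d x < d y) → ∃ u v : Set X,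
          IsOpen[TopologicalSpace.generateFrom I] u ∧ IsOpen[TopologicalSpace.generateFrom I] v ∧
          x ∈ u ∧ y ∈ v ∧ Disjoint u v := by
        rintro x y ⟨d, hd, hlt⟩
        obtain ⟨q, hxq, hqy⟩ := exists_rat_btwn hlt
        obtain ⟨a, ha⟩ := exists_rat_lt (d x)
        obtain ⟨b, hb⟩ := exists_rat_gt (d y)
        refine ⟨_, _, TopologicalSpace.isOpen_generateFrom_of_mem ⟨(⟨d, hd⟩, a, q), rfl⟩,
          TopologicalSpace.isOpen_generateFrom_of_mem ⟨(⟨d, hd⟩, q, b), rfl⟩, ⟨ha, hxq⟩,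
          ⟨hqy, hb⟩, ?_⟩
        exact Disjoint.preimage _ (Set.disjoint_left.2 fun z hz hz' => lt_asymm hz.2 hz'.1)
      obtain ⟨d, hd, hne⟩ := hsep x y hxy
      rcases lt_or_gt_of_ne hne with hlt | hlt
      · exact aux x y ⟨d, hd, hlt⟩
      · obtain ⟨u, v, hu, hv, hyu, hxv, huv⟩ := aux y x ⟨d, hd, hlt⟩
        exact ⟨v, u, hv, hu, hxv, hyu, huv.symm⟩
    have hind := @Continuous.eq_induced_of_injective X X tX (TopologicalSpace.generateFrom I) _ hT2 id
      (continuous_id_iff_le.2 hle) Function.injective_id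
    exact hind.trans (@induced_id X (TopologicalSpace.generateFrom I))
  refine topWeight_le (TopologicalSpace.isTopologicalBasis_of_subbasis hgen) hκ
    (mk_image_le.trans ?_)
  refine le_trans ?_ (mk_finset_le hκ hIc)
  refine mk_le_of_surjective (f := fun F : Finset I =>
    ⟨Subtype.val '' (F : Set I), F.finite_toSet.image _, by simp⟩) ?_
  rintro ⟨F, hF, hFI⟩
  lift F to Set I using hFI
  have hF' : F.Finite := hF.of_finite_image Subtype.val_injective.injOn
  exact ⟨hF'.toFinset, by simp⟩

end Weight

/-! ### Continuous functions on Lindelöf Σ-spaces -/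

section LindelofSigma

/-- A Hausdorff space with a network of cardinality `κ` has a family of at most `κ` open sets
that separates every point from every compact set not containing it. -/
theorem exists_open_family_separating {X : Type u} [TopologicalSpace X] [T2Space X]
    {N : Set (Set X)} (hN : IsNetwork N) {κ : Cardinal.{u}} (hκ : ℵ₀ ≤ κ) (hNc : #N ≤ κ) :
    ∃ 𝒰 : Set (Set X), #𝒰 ≤ κ ∧ (∀ U ∈ 𝒰, IsOpen U) ∧ ∀ (x : X) (C : Set X), IsCompact C → x ∉ C →
      ∃ U ∈ 𝒰, x ∈ U ∧ ∃ V, IsOpen V ∧ C ⊆ V ∧ Disjoint U V := by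
  classical
  -- One disjoint open pair is fixed for each pair of network elements that admits one, with an
  -- empty default otherwise; this keeps the count at `κ`.
  have hch : ∀ p : N × N, ∃ U V : Set X, IsOpen U ∧ IsOpen V ∧ Disjoint U V ∧
      ((∃ U' V' : Set X, IsOpen U' ∧ IsOpen V' ∧ Disjoint U' V' ∧ p.1.1 ⊆ U' ∧ p.2.1 ⊆ V') →
        p.1.1 ⊆ U ∧ p.2.1 ⊆ V) := by
    intro p
    by_cases h : ∃ U' V' : Set X, IsOpen U' ∧ IsOpen V' ∧ Disjoint U' V' ∧ p.1.1 ⊆ U' ∧ p.2.1 ⊆ V'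
    · obtain ⟨U, V, hU, hV, hUV, h1, h2⟩ := h
      exact ⟨U, V, hU, hV, hUV, fun _ => ⟨h1, h2⟩⟩
    · exact ⟨∅, ∅, isOpen_empty, isOpen_empty, disjoint_bot_left, fun h' => (h h').elim⟩
  choose U V hU hV hUV hsub using hch
  have hpt : ∀ x y : X, x ≠ y → ∃ p : N × N, x ∈ U p ∧ y ∈ V p := by
    intro x y hxy
    obtain ⟨U', V', hU', hV', hx, hy, hd⟩ := t2_separation hxy
    obtain ⟨M, hM, rfl⟩ := hN U' hU'
    obtain ⟨M', hM', rfl⟩ := hN V' hV'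
    obtain ⟨A, hA, hxA⟩ := hx
    obtain ⟨A', hA', hyA'⟩ := hy
    have := hsub (⟨A, hM hA⟩, ⟨A', hM' hA'⟩)
      ⟨_, _, hU', hV', hd, subset_sUnion_of_mem hA, subset_sUnion_of_mem hA'⟩
    exact ⟨_, this.1 hxA, this.2 hyA'⟩
  refine ⟨range fun F : Finset (N × N) => ⋂ p ∈ F, U p, ?_, ?_, ?_⟩
  · refine mk_range_le.trans (mk_finset_le hκ ?_)
    rw [mk_prod, lift_id]
    exact mul_le_of_le hκ hNc hNc
  · rintro _ ⟨F, rfl⟩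
    exact isOpen_biInter_finset fun p _ => hU p
  · intro x C hC hx
    obtain ⟨F, hF⟩ := hC.elim_finite_subcover (fun p : {p : N × N // x ∈ U p} => V p.1)
      (fun p => hV _) (fun y hy => by
        obtain ⟨p, hp, hp'⟩ := hpt x y (fun h => hx (h ▸ hy))
        exact mem_iUnion.2 ⟨⟨p, hp⟩, hp'⟩)
    refine ⟨_, ⟨F.image Subtype.val, rfl⟩, ?_, _, isOpen_biUnion fun p _ => hV p.1, hF, ?_⟩
    · simp only [mem_iInter, Finset.mem_image]
      rintro _ ⟨p, -, rfl⟩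
      exact p.2
    · rw [Set.disjoint_left]
      intro z hz hz'
      obtain ⟨p, hp, hzp⟩ := mem_iUnion₂.1 hz'
      exact Set.disjoint_left.1 (hUV p.1)
        (mem_iInter₂.1 hz p.1 (Finset.mem_image_of_mem _ hp)) hzp

/-- A Hausdorff Lindelöf Σ-space with a network of cardinality `κ` has a family `𝒯` of at most `κ`
subsets such that every continuous real function is determined, up to arbitrarily small errors at
every point, by countably many inclusions `f '' T ⊆ (q, r)` with `T ∈ 𝒯`. -/
theorem IsLindelofSigmaSpace.exists_family {X : Type u} [TopologicalSpace X] [T2Space X]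
    (hX : IsLindelofSigmaSpace.{u, v} X) {N : Set (Set X)} (hN : IsNetwork N)
    {κ : Cardinal.{u}} (hκ : ℵ₀ ≤ κ) (hNc : #N ≤ κ) :
    ∃ 𝒯 : Set (Set X), #𝒯 ≤ κ ∧ ∀ f : X → ℝ, Continuous f →
      ∃ P : Set (𝒯 × ℚ × ℚ), P.Countable ∧
        (∀ p ∈ P, ∀ x ∈ p.1.1, f x ∈ Ioo (p.2.1 : ℝ) p.2.2) ∧
        ∀ (x : X), ∀ ε > 0, ∃ p ∈ P, x ∈ p.1.1 ∧ (p.2.2 - p.2.1 : ℝ) < ε := by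
  classical
  obtain ⟨Y, _, g, ⟨-, Z, _, p, -, _, ⟨hp, hpc, hpk⟩, -⟩, hg, hgs⟩ := hX
  obtain ⟨𝒰, h𝒰c, h𝒰o, h𝒰⟩ := exists_open_family_separating hN hκ hNc
  obtain ⟨O, hO⟩ := TopologicalSpace.exists_seq_basis Z
  let S : ℕ → Set X := fun n => g '' (p ⁻¹' O n)
  let T : ℕ × 𝒰 → Set X := fun q => S q.1 ∩ q.2
  refine ⟨range T, ?_, fun f hf => ?_⟩
  · refine mk_range_le.trans ?_
    rw [mk_prod]
    simp only [lift_uzero, mk_nat, lift_aleph0]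
    exact mul_le_of_le hκ hκ h𝒰c
  -- Closedness of `p`: a neighbourhood of a fibre contains the preimage of a basic neighbourhood of
  -- the point.
  have hfib : ∀ z W, IsOpen W → g '' (p ⁻¹' {z}) ⊆ W → ∃ n, z ∈ O n ∧ S n ⊆ W := by
    intro z W hW hzW
    have h1 : ∀ᶠ z' in 𝓝 z, ∀ y ∈ p ⁻¹' {z'}, g y ∈ W :=
      hpc.eventually_nhds_fiber z fun y hy =>
        (hW.preimage hg).mem_nhds (hzW (mem_image_of_mem g hy))
    obtain ⟨_, ⟨n, rfl⟩, hzn, hn⟩ := hO.mem_nhds_iff.1 h1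
    refine ⟨n, hzn, ?_⟩
    rintro _ ⟨y, hy, rfl⟩
    exact hn hy y rfl
  have hloc : ∀ (z : Z) (m : ℕ), ∀ x ∈ g '' (p ⁻¹' {z}), ∃ n, z ∈ O n ∧ ∃ U ∈ 𝒰, x ∈ U ∧
      ∃ a b : ℚ, (b - a : ℝ) < 1 / (m + 1) ∧ ∀ y ∈ S n ∩ U, f y ∈ Ioo (a : ℝ) b := by
    intro z m x hx
    have hm : (0 : ℝ) < 1 / (m + 1) := by positivity
    obtain ⟨a, ha, ha'⟩ := exists_rat_btwn (show f x - 1 / (m + 1) / 2 < f x by linarith)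
    obtain ⟨b, hb, hb'⟩ := exists_rat_btwn (show f x < f x + 1 / (m + 1) / 2 by linarith)
    have hJ : IsOpen (f ⁻¹' Ioo (a : ℝ) b) := isOpen_Ioo.preimage hf
    have hCz : IsCompact (g '' (p ⁻¹' {z})) := (hpk z).image hg
    -- Only the compact part of the fibre image where `f` leaves the interval has to be separated
    -- from `x`; the rest is already good.
    obtain ⟨U, hU, hxU, V, hV, hCV, hUV⟩ := h𝒰 x _ (hCz.diff hJ) (fun h => h.2 ⟨ha', hb⟩)
    obtain ⟨n, hzn, hn⟩ := hfib z (V ∪ f ⁻¹' Ioo (a : ℝ) b) (hV.union hJ) (fun y hy => by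
      by_cases h : y ∈ f ⁻¹' Ioo (a : ℝ) b
      · exact Or.inr h
      · exact Or.inl (hCV ⟨hy, h⟩))
    refine ⟨n, hzn, U, hU, hxU, a, b, by linarith, fun y hy => ?_⟩
    exact (hn hy.1).resolve_left (Set.disjoint_left.1 hUV hy.2)
  have hcov : ∀ (z : Z) (m : ℕ), ∃ n, z ∈ O n ∧ ∃ F : Finset (range T × ℚ × ℚ),
      (∀ q ∈ F, (q.2.2 - q.2.1 : ℝ) < 1 / (m + 1) ∧ ∀ y ∈ q.1.1, f y ∈ Ioo (q.2.1 : ℝ) q.2.2) ∧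
      ∀ x ∈ S n, ∃ q ∈ F, x ∈ q.1.1 := by
    intro z m
    have hCz : IsCompact (g '' (p ⁻¹' {z})) := (hpk z).image hg
    choose! k hk U hU hxU a b hab hfab using hloc z m
    obtain ⟨F, hFC, hF⟩ := hCz.elim_nhds_subcover U
      fun x hx => (h𝒰o _ (hU x hx)).mem_nhds (hxU x hx)
    obtain ⟨W, hW, hzW, hWk⟩ : ∃ W, IsOpen W ∧ z ∈ W ∧ ∀ x ∈ F, W ⊆ O (k x) :=
      ⟨⋂ x ∈ F, O (k x), isOpen_biInter_finset fun x _ => hO.isOpen (mem_range_self _),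
        mem_iInter₂.2 fun x hx => hk x (hFC x hx), fun x hx => biInter_subset_of_mem hx⟩
    obtain ⟨n, hzn, hn⟩ := hfib z _ (isOpen_biUnion fun x hx => h𝒰o _ (hU x (hFC x hx))) hF
    -- Shrinking to `O l` puts `S l` inside all the finitely many `S (k x)`, so the sets `S (k x) ∩
    -- U x` cover it.
    obtain ⟨_, ⟨l, rfl⟩, hzl, hl⟩ := hO.exists_subset_of_mem_open (show z ∈ O n ∩ W from ⟨hzn, hzW⟩)
      ((hO.isOpen (mem_range_self n)).inter hW)
    refine ⟨l, hzl, F.attach.image fun x =>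
      (⟨T (k x.1, ⟨U x.1, hU x.1 (hFC x.1 x.2)⟩), mem_range_self _⟩, a x.1, b x.1), ?_, ?_⟩
    · intro q hq
      obtain ⟨x, -, rfl⟩ := Finset.mem_image.1 hq
      exact ⟨hab x.1 (hFC x.1 x.2), hfab x.1 (hFC x.1 x.2)⟩
    · rintro _ ⟨y, hy, rfl⟩
      obtain ⟨x, hx, hyx⟩ := mem_iUnion₂.1 (hn ⟨y, (hl hy).1, rfl⟩)
      exact ⟨_, Finset.mem_image_of_mem _ (Finset.mem_attach F ⟨x, hx⟩),
        ⟨y, hWk x hx (hl hy).2, rfl⟩, hyx⟩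
  -- There may be uncountably many `z`, so one finite cover is chosen per pair (basic set,
  -- precision) instead, empty if none exists; this makes `P` countable.
  have hch : ∀ q : ℕ × ℕ, ∃ F : Finset (range T × ℚ × ℚ),
      (∀ t ∈ F, (t.2.2 - t.2.1 : ℝ) < 1 / (q.2 + 1) ∧ ∀ y ∈ t.1.1, f y ∈ Ioo (t.2.1 : ℝ) t.2.2) ∧
      ((∃ F' : Finset (range T × ℚ × ℚ), (∀ t ∈ F', (t.2.2 - t.2.1 : ℝ) < 1 / (q.2 + 1) ∧
        ∀ y ∈ t.1.1, f y ∈ Ioo (t.2.1 : ℝ) t.2.2) ∧ ∀ x ∈ S q.1, ∃ t ∈ F', x ∈ t.1.1) →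
        ∀ x ∈ S q.1, ∃ t ∈ F, x ∈ t.1.1) := by
    intro q
    by_cases h : ∃ F' : Finset (range T × ℚ × ℚ), (∀ t ∈ F', (t.2.2 - t.2.1 : ℝ) < 1 / (q.2 + 1) ∧
        ∀ y ∈ t.1.1, f y ∈ Ioo (t.2.1 : ℝ) t.2.2) ∧ ∀ x ∈ S q.1, ∃ t ∈ F', x ∈ t.1.1
    · obtain ⟨F, hF, hF'⟩ := h
      exact ⟨F, hF, fun _ => hF'⟩
    · exact ⟨∅, by simp, fun h' => (h h').elim⟩
  choose F hF hFS using hch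
  refine ⟨⋃ q, (F q : Set (range T × ℚ × ℚ)),
    countable_iUnion fun q => (F q).countable_toSet, ?_, ?_⟩
  · intro t ht
    obtain ⟨q, hq⟩ := mem_iUnion.1 ht
    exact (hF q t hq).2
  · intro x ε hε
    obtain ⟨y, rfl⟩ := hgs x
    obtain ⟨m, hm⟩ := exists_nat_one_div_lt hε
    obtain ⟨n, hzn, F', hF', hFn⟩ := hcov (p y) m
    obtain ⟨t, ht, hyt⟩ := hFS (n, m) ⟨F', hF', hFn⟩ (g y) ⟨y, hzn, rfl⟩
    exact ⟨t, mem_iUnion.2 ⟨_, ht⟩, hyt, (hF _ t ht).1.trans hm⟩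

/-- On a Hausdorff Lindelöf Σ-space with a network of cardinality `κ`, every family of continuous
functions contains a subfamily of cardinality at most `κ` whose pointwise sequential closure
contains the family. -/
theorem IsLindelofSigmaSpace.exists_sequentially_dense {X : Type u} [TopologicalSpace X] [T2Space X]
    (hX : IsLindelofSigmaSpace.{u, v} X) {N : Set (Set X)} (hN : IsNetwork N)
    {κ : Cardinal.{u}} (hκ : ℵ₀ ≤ κ) (hNc : #N ≤ κ) {α : Type u} {A : Set α} (ev : α → X → ℝ)
    (hev : ∀ a ∈ A, Continuous (ev a)) :
    ∃ D ⊆ A, #D ≤ κ ∧ ∀ a ∈ A, ∃ d : ℕ → α, (∀ n, d n ∈ D) ∧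
      ∀ x, Tendsto (fun n => ev (d n) x) atTop (𝓝 (ev a x)) := by
  classical
  obtain ⟨𝒯, h𝒯c, h𝒯⟩ := hX.exists_family hN hκ hNc
  let good : α → 𝒯 × ℚ × ℚ → Prop := fun a p => ∀ x ∈ p.1.1, ev a x ∈ Ioo (p.2.1 : ℝ) p.2.2
  rcases A.eq_empty_or_nonempty with rfl | ⟨a₀, ha₀⟩
  · exact ⟨∅, Subset.rfl, by simp, by simp⟩
  -- One representative in `A` per finite set of constraints, with `a₀` as default when the
  -- constraints cannot be met.
  have hch : ∀ F : Finset (𝒯 × ℚ × ℚ), ∃ a ∈ A, (∃ a' ∈ A, ∀ p ∈ F, good a' p) →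
      ∀ p ∈ F, good a p := by
    intro F
    by_cases h : ∃ a' ∈ A, ∀ p ∈ F, good a' p
    · obtain ⟨a, ha, haF⟩ := h
      exact ⟨a, ha, fun _ => haF⟩
    · exact ⟨a₀, ha₀, fun h' => (h h').elim⟩
  choose c hcA hc using hch
  refine ⟨range c, range_subset_iff.2 hcA, ?_, fun a ha => ?_⟩
  · refine mk_range_le.trans (mk_finset_le hκ ?_)
    rw [mk_prod]
    simp only [lift_uzero]
    exact mul_le_of_le hκ h𝒯c (by simpa using hκ)
  · obtain ⟨P, hPc, hP, hPx⟩ := h𝒯 (ev a) (hev a ha)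
    rcases isEmpty_or_nonempty X with hXe | ⟨⟨x₀⟩⟩
    · exact ⟨fun _ => c ∅, fun _ => mem_range_self _, fun x => isEmptyElim x⟩
    obtain ⟨p₀, hp₀, -⟩ := hPx x₀ 1 one_pos
    obtain ⟨s, rfl⟩ := hPc.exists_eq_range ⟨p₀, hp₀⟩
    -- The `n`-th term satisfies the constraints `s 0, …, s n`, all met by `a`. Once `n ≥ k`, both
    -- values at `x` lie in the same interval of length less than `ε`.
    refine ⟨fun n => c ((Finset.range (n + 1)).image s), fun n => mem_range_self _, fun x => ?_⟩
    rw [Metric.tendsto_atTop]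
    intro ε hε
    obtain ⟨_, ⟨k, rfl⟩, hxk, hk⟩ := hPx x ε hε
    refine ⟨k, fun n hn => ?_⟩
    have h1 := hP _ (mem_range_self k) x hxk
    have h2 := hc ((Finset.range (n + 1)).image s) ⟨a, ha, fun p hp => by
      obtain ⟨i, -, rfl⟩ := Finset.mem_image.1 hp
      exact hP _ (mem_range_self i)⟩ (s k)
      (Finset.mem_image_of_mem _ (Finset.mem_range.2 (by omega))) x hxk
    rw [Real.dist_eq, abs_lt]
    constructor <;> linarith [h1.1, h1.2, h2.1, h2.2]

end LindelofSigma

/-! ### The main theorem -/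

/-- A compact convex set has weight at most the network weight of any boundary that is a Lindelöf
Σ-space. -/
theorem topWeight_le_netWeight_of_isBoundaryOf {E : Type u} [AddCommGroup E] [Module ℝ E]
    [TopologicalSpace E] [IsTopologicalAddGroup E] [ContinuousSMul ℝ E] [LocallyConvexSpace ℝ E]
    [T2Space E] {K B : Set E} (hK : IsCompact K) (hB : IsBoundaryOf B K)
    (hS : IsLindelofSigmaSpace.{u, v} (B : Type u)) : topWeight K ≤ netWeight B := by
  have : CompactSpace K := isCompact_iff_compactSpace.1 hK
  obtain ⟨N, hN, hNc⟩ := exists_isNetwork_mk_le B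
  have hκ := aleph0_le_netWeight B
  -- The common bound 1 provides the uniform boundedness required by Simons' lemma; the Hahn–Banach
  -- functional is rescaled below to meet it.
  let A : Set (E → ℝ) := {f | IsContAffineOn K f ∧ ∀ y ∈ K, |f y| ≤ 1}
  obtain ⟨D, hDA, hDc, hD⟩ := hS.exists_sequentially_dense hN hκ hNc (A := A)
    (fun f b => f b) fun f hf => continuousOn_iff_continuous_domRestrict.1 (hf.1.1.mono hB.1)
  refine topWeight_le_of_separates (D := (fun (f : E → ℝ) (y : K) => f y) '' D) ?_ ?_ hκ
    (mk_image_le.trans hDc)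
  · rintro _ ⟨d, hd, rfl⟩
    exact continuousOn_iff_continuous_domRestrict.1 (hDA hd).1.1
  · rintro ⟨x, hx⟩ ⟨y, hy⟩ hxy
    obtain ⟨f, hf⟩ := geometric_hahn_banach_point_point (E := E) (fun h => hxy (Subtype.ext h))
    obtain ⟨M, hM⟩ := hK.exists_bound_of_continuousOn f.continuous.continuousOn
    have hM1 : 0 < max M 1 := lt_max_of_lt_right one_pos
    have hfA : (fun z => (max M 1)⁻¹ * f z) ∈ A := by
      refine ⟨(IsContAffineOn.of_strongDual f).const_mul _, fun z hz => ?_⟩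
      rw [abs_mul, abs_of_pos (inv_pos.2 hM1), inv_mul_le_one₀ hM1]
      exact (hM z hz).trans (le_max_left _ _)
    obtain ⟨d, hdD, hd⟩ := hD _ hfA
    have hlim : ∀ z ∈ K, Tendsto (fun n => d n z) atTop (𝓝 ((max M 1)⁻¹ * f z)) := fun z hz =>
      hB.tendsto_of_tendsto (fun n => (hDA (hdD n)).1) hfA.1 (fun n => (hDA (hdD n)).2) hfA.2
        (fun b hb => hd ⟨b, hb⟩) hz
    by_contra! hcon
    have heq : ∀ n, d n x = d n y := fun n => hcon _ ⟨d n, hdD n, rfl⟩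
    have := tendsto_nhds_unique (hlim x hx) (by simpa only [heq] using hlim y hy)
    exact hf.ne (mul_left_cancel₀ (inv_pos.2 hM1).ne' this)

theorem theoremt {E : Type u} [AddCommGroup E] [Module ℝ E] [TopologicalSpace E]
    [IsTopologicalAddGroup E] [ContinuousSMul ℝ E] [LocallyConvexSpace ℝ E] [T2Space E]
    (K B : Set E) (hKcompact : IsCompact K) (hKconvex : Convex ℝ K)
    (hB : IsBoundaryOf B K) (hSigma : IsLindelofSigmaSpace.{u, v} (B : Type u)) :
    topWeight K ≤ netWeight B ∧ topWeight K = netWeight B := by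
  have h := topWeight_le_netWeight_of_isBoundaryOf hKcompact hB hSigma
  exact ⟨h, h.antisymm (netWeight_le_topWeight_of_isInducing
    (IsEmbedding.inclusion hB.1).isInducing)⟩
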